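/- Let $\mathcal A$ be a finite set of advertisers, $\mathcal A_0=\mathcal A\cup\{0\}$, and let $Q=(Q_a)_{a\in\mathcal A}$ be a random vector of qualities with values in a measurable set $\Omega\subseteq\mathbb R^{\mathcal A}$ (for instance a compact one) and with finite second moments; put $Q_0=0$, and $v_0=0$ for every $v\in\mathbb R^{\mathcal A}$. Let $r:[0,1]\to\mathbb R$ be a regular revenue function, i.e. continuous, concave, non-negative, bounded, with $\lim_{s\downarrow0}r(s)=0$. For $c\in\mathbb R$ let $R(c)=\max_{s\in[0,1]}\{r(s)+(1-s)c\}$ and let $s^*(c)$ be the least maximizer. Let $N\in\mathbb N$ and $\rho\in\mathbb R^{\mathcal A}$. The deterministic approximation problem (DAP) is to maximize $$\sum_{n=1}^N\mathbb E\Big[r(s_n(Q))+\sum_{a\in\mathcal A}i_{n,a}(Q)\,Q_a\Big]$$ over measurable functions $s_n,i_{n,a}$ that satisfy $s_n\ge0$, $i_{n,a}\ge0$ and $s_n+\sum_{a\in\mathcal A}i_{n,a}\le1$ on $\Omega$, subject to $\sum_{n=1}^N\mathbb E[i_{n,a}(Q)]=N\rho_a$ for all $a\in\mathcal A$. Here $s_n(Q)$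 is the probability that the impression is accepted by the ad exchange, $i_{n,a}(Q)$ the total probability that it is assigned to advertiser $a$, and $I_{n,a}(Q)=i_{n,a}(Q)/(1-s_n(Q))$ the conditional probability of that assignment given rejection by the exchange. Its dual problem is to minimize over $v\in\mathbb R^{\mathcal A}$ $$\psi(v)=\mathbb E\Big[R\big(\max_{a\in\mathcal A_0}\{Q_a-v_a\}\big)\Big]+\sum_{a\in\mathcal A}v_a\rho_a .$$ **Theorem.** Let $v$ be optimal for the dual problem. Assume that $\mathbb P\{Q_a-v_a=Q_{a'}-v_{a'}\}=0$ for all distinct $a,a'\in\mathcal A_0$, and that almost surely, if $\lambda(Q):=\max_{a\in\mathcal A_0}\{Q_a-v_a\}$ is positive, then the maximizer in the definition of $R(\lambda(Q))$ is unique (this holds, for example, if $r$ is strictly concave, or if no $Q_a$ has an atom). Then the maximum $\lambda(Q)$ is almost surely attained by exactly one $a\in\mathcal A_0$, and the time-homogeneous controls $$s(Q)=s^*\Big(\max_{a\in\mathcal A_0}\{Q_a-v_a\}\Big),\qquad I_a(Q)=\mathbf 1\{Q_a-v_a>Q_{a'}-v_{a'}\ \ \forall a'\in\mathcal A_0\setminus\{a\}\},$$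 i.e. $s_n=s$ and $i_{n,a}=(1-s)I_a$ for all $n$ and all $a\in\mathcal A$, are optimal (in particular feasible) for the DAP. Furthermore, $v$ solves $$\mathbb E\big[(1-s^*(Q_a-v_a))\,I_a(Q)\big]=\rho_a\qquad\text{for all }a\in\mathcal A .$$ -/

import Mathlib

open MeasureTheory Set Filter Topology

noncomputable section

namespace AdX

/-- A regular revenue function `r : [0,1] → ℝ` (only its values on `[0,1]` are used):
continuous, concave, non-negative, bounded, with `r(s) → 0` as `s ↓ 0`. -/
structure IsRegularRevenue (r : ℝ → ℝ) : Prop where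
  continuousOn : ContinuousOn r (Icc 0 1)
  concaveOn : ConcaveOn ℝ (Icc 0 1) r
  nonneg : ∀ s ∈ Icc (0 : ℝ) 1, 0 ≤ r s
  bounded : ∃ M : ℝ, ∀ s ∈ Icc (0 : ℝ) 1, r s ≤ M
  tendsto_zero : Tendsto r (𝓝[>] 0) (𝓝 0)

/-- The value function `R(c) = max_{s ∈ [0,1]} r(s) + (1 - s) c`. -/
def value (r : ℝ → ℝ) (c : ℝ) : ℝ :=
  sSup ((fun s : ℝ => r s + (1 - s) * c) '' Icc 0 1)

/-- The set of maximizers of `s ↦ r(s) + (1 - s) c` over `[0,1]`. -/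
def maximizers (r : ℝ → ℝ) (c : ℝ) : Set ℝ :=
  {s | s ∈ Icc (0 : ℝ) 1 ∧ ∀ t ∈ Icc (0 : ℝ) 1, r t + (1 - t) * c ≤ r s + (1 - s) * c}

/-- `s*(c)`, the least maximizer; see `sStar_isLeast`. -/
def sStar (r : ℝ → ℝ) (c : ℝ) : ℝ := sInf (maximizers r c)

/-- For a regular revenue function, `sStar` is indeed the least maximizer. -/
theorem sStar_isLeast {r : ℝ → ℝ} (hr : IsRegularRevenue r) (c : ℝ) :
    IsLeast (maximizers r c) (sStar r c) := by
  have hc : ContinuousOn (fun s : ℝ => r s + (1 - s) * c) (Icc 0 1) :=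
    hr.continuousOn.add (by fun_prop)
  obtain ⟨s₀, hs₀, hmax⟩ := isCompact_Icc.exists_isMaxOn (nonempty_Icc.2 zero_le_one) hc
  have hEq : maximizers r c = Icc (0 : ℝ) 1 ∩ (fun s : ℝ => r s + (1 - s) * c) ⁻¹'
      Ici (r s₀ + (1 - s₀) * c) := by
    ext s
    constructor
    · rintro ⟨hs, h⟩
      exact ⟨hs, h s₀ hs₀⟩
    · rintro ⟨hs, h⟩
      exact ⟨hs, fun t ht => le_trans (hmax ht) h⟩
  have hclosed : IsClosed (maximizers r c) := by
    rw [hEq]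
    exact hc.preimage_isClosed_of_isClosed isClosed_Icc isClosed_Ici
  have hcomp : IsCompact (maximizers r c) :=
    isCompact_Icc.of_isClosed_subset hclosed fun s hs => hs.1
  exact hcomp.isLeast_sInf ⟨s₀, hs₀, fun t ht => hmax ht⟩

variable {ι : Type*} [Fintype ι]

/-- The contract adjusted quality `Q_a - v_a` for `a ∈ A₀ = A ∪ {0}`. The outside option `0`
is `none`, with `Q_0 = 0` and `v_0 = 0`. -/
def adj (v q : ι → ℝ) : Option ι → ℝ
  | none => 0
  | some a => q a - v a

/-- `max_{a ∈ A₀} {Q_a - v_a}`. -/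
def maxAdj (v q : ι → ℝ) : ℝ := ⨆ o : Option ι, adj v q o

open Classical in
/-- `I_a(Q)`: the indicator that `Q_a - v_a` strictly exceeds `Q_{a'} - v_{a'}` for every other
`a' ∈ A₀`. -/
def assign (v : ι → ℝ) (a : ι) (q : ι → ℝ) : ℝ :=
  if ∀ o : Option ι, o ≠ some a → adj v q o < adj v q (some a) then 1 else 0

/-- The set `P` of controls `(s, i)` for one impression with qualities in `Ω`: `s q` is the
probability that the impression is accepted by the exchange and `i a q` the total probability that
it is assigned to advertiser `a`. -/
structure IsControl (Ω : Set (ι → ℝ)) (s : (ι → ℝ) → ℝ) (i : ι → (ι → ℝ) → ℝ) : Prop where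
  measurable_s : Measurable s
  measurable_i : ∀ a, Measurable (i a)
  nonneg_s : ∀ q ∈ Ω, 0 ≤ s q
  nonneg_i : ∀ q ∈ Ω, ∀ a, 0 ≤ i a q
  sum_le_one : ∀ q ∈ Ω, ∑ a, i a q + s q ≤ 1

/-- Feasibility for the deterministic approximation problem with `N` impressions. -/
structure IsFeasible {N : ℕ} (Ω : Set (ι → ℝ)) (G : Measure (ι → ℝ)) (ρ : ι → ℝ)
    (s : Fin N → (ι → ℝ) → ℝ) (i : Fin N → ι → (ι → ℝ) → ℝ) : Prop where
  control : ∀ n, IsControl Ω (s n) (i n)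
  capacity : ∀ a, ∑ n, ∫ q, i n a q ∂G = N * ρ a

/-- The expected yield of the controls `(s_n, i_n)`. -/
def yield {N : ℕ} (G : Measure (ι → ℝ)) (r : ℝ → ℝ)
    (s : Fin N → (ι → ℝ) → ℝ) (i : Fin N → ι → (ι → ℝ) → ℝ) : ℝ :=
  ∑ n, ∫ q, (r (s n q) + ∑ a, i n a q * q a) ∂G

/-- Optimality for the deterministic approximation problem. -/
def IsOptimal {N : ℕ} (Ω : Set (ι → ℝ)) (G : Measure (ι → ℝ)) (r : ℝ → ℝ) (ρ : ι → ℝ)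
    (s : Fin N → (ι → ℝ) → ℝ) (i : Fin N → ι → (ι → ℝ) → ℝ) : Prop :=
  IsFeasible Ω G ρ s i ∧
    ∀ (s' : Fin N → (ι → ℝ) → ℝ) (i' : Fin N → ι → (ι → ℝ) → ℝ),
      IsFeasible Ω G ρ s' i' → yield G r s' i' ≤ yield G r s i

/-- The dual objective `ψ(v) = E[R(max_{a ∈ A₀} {Q_a - v_a})] + ∑_{a ∈ A} v_a ρ_a`. -/
def dual (G : Measure (ι → ℝ)) (r : ℝ → ℝ) (ρ v : ι → ℝ) : ℝ :=
  ∫ q, value r (maxAdj v q) ∂G + ∑ a, v a * ρ a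

/-- `v` is a vector of optimal dual variables: it minimizes `ψ` over `ℝ^A`. -/
def IsDualOptimal (G : Measure (ι → ℝ)) (r : ℝ → ℝ) (ρ v : ι → ℝ) : Prop :=
  ∀ w : ι → ℝ, dual G r ρ v ≤ dual G r ρ w

end AdX

end

namespace AdX

/-! ### The value function R and its least maximizer. -/

section Revenue

variable {r : ℝ → ℝ}

/-! This is Lagrangian duality. With `v a` as the price of advertiser a's capacity and λ the largest
adjusted quality, every control earns pointwise at most R(λ) + ∑ v_a i_a. Integrating and using the
capacity constraint bounds every feasible yield by N ψ(v) (`IsFeasible.yield_le_dual`). The proposed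
policy attains equality wherever there is no tie (`yield_sStar_assign_eq`), so only its feasibility
is left.

Feasibility is stationarity of ψ at v (`integral_assign_eq`). Off ties λ is locally a single
adjusted quality, and R has derivative 1 - s* at a point with a unique maximizer. Differentiating
under the integral gives ∂ψ/∂v_a = ρ_a - E[(1 - s*(λ)) I_a]. -/

theorem IsRegularRevenue.sStar_mem_Icc (hr : IsRegularRevenue r) (c : ℝ) :
    sStar r c ∈ Icc (0 : ℝ) 1 :=
  (sStar_isLeast hr c).1.1

theorem IsRegularRevenue.value_eq (hr : IsRegularRevenue r) (c : ℝ) :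
    value r c = r (sStar r c) + (1 - sStar r c) * c := by
  obtain ⟨h1, h2⟩ := (sStar_isLeast hr c).1
  refine IsGreatest.csSup_eq ⟨⟨_, h1, rfl⟩, ?_⟩
  rintro _ ⟨t, ht, rfl⟩
  exact h2 t ht

theorem IsRegularRevenue.le_value (hr : IsRegularRevenue r) (c : ℝ) {s : ℝ}
    (hs : s ∈ Icc (0 : ℝ) 1) : r s + (1 - s) * c ≤ value r c := by
  rw [hr.value_eq]
  exact (sStar_isLeast hr c).1.2 s hs

/-- R is a supremum of affine functions with slopes 1 - s, so the slope active at c is a subgradient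
there. The Lipschitz bound, monotonicity of s* and the envelope theorem all rest on this. -/
theorem IsRegularRevenue.sub_mul_le_value_sub (hr : IsRegularRevenue r) (c d : ℝ) :
    (1 - sStar r c) * (d - c) ≤ value r d - value r c := by
  have := hr.le_value d (hr.sStar_mem_Icc c)
  rw [hr.value_eq c]
  linarith

theorem IsRegularRevenue.abs_value_sub_le (hr : IsRegularRevenue r) (c d : ℝ) :
    |value r c - value r d| ≤ |c - d| := by
  have key : ∀ x y : ℝ, value r x - value r y ≤ |x - y| := by
    intro x y
    have h := hr.sub_mul_le_value_sub x y
    obtain ⟨h0, h1⟩ := hr.sStar_mem_Icc x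
    have h2 : (1 - sStar r x) * (x - y) ≤ (1 - sStar r x) * |x - y| :=
      mul_le_mul_of_nonneg_left (le_abs_self _) (by linarith)
    have h3 : (1 - sStar r x) * |x - y| ≤ |x - y| :=
      mul_le_of_le_one_left (abs_nonneg _) (by linarith)
    linarith
  refine abs_le.2 ⟨?_, key c d⟩
  have := key d c
  rw [abs_sub_comm] at this
  linarith

theorem IsRegularRevenue.continuous_value (hr : IsRegularRevenue r) : Continuous (value r) :=
  (LipschitzWith.of_dist_le_mul (K := 1) fun x y => by
    simpa [Real.dist_eq] using hr.abs_value_sub_le x y).continuous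

theorem IsRegularRevenue.antitone_sStar (hr : IsRegularRevenue r) : Antitone (sStar r) := by
  intro c d hcd
  rcases hcd.eq_or_lt with rfl | hlt
  · exact le_rfl
  have h1 := hr.sub_mul_le_value_sub c d
  have h2 := hr.sub_mul_le_value_sub d c
  by_contra! h
  nlinarith

/-- The least maximizer is continuous wherever the maximizer is unique. -/
theorem IsRegularRevenue.tendsto_sStar (hr : IsRegularRevenue r) {c : ℝ}
    (hc : (maximizers r c).Subsingleton) : Tendsto (sStar r) (𝓝 c) (𝓝 (sStar r c)) := by
  refine isCompact_Icc.tendsto_nhds_of_unique_mapClusterPt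
    (Eventually.of_forall hr.sStar_mem_Icc) ?_
  -- Optimality passes to the limit along an ultrafilter, so any cluster point x is a maximizer at
  -- c.
  intro x hx hcl
  refine hc ⟨hx, fun t ht => ?_⟩ (sStar_isLeast hr c).1
  obtain ⟨U, hU, hlim⟩ := mapClusterPt_iff_ultrafilter.1 hcl
  have hlim' : Tendsto (sStar r) U (𝓝[Icc 0 1] x) :=
    tendsto_nhdsWithin_iff.2 ⟨hlim, Eventually.of_forall hr.sStar_mem_Icc⟩
  have hr' : Tendsto (fun d => r (sStar r d)) U (𝓝 (r x)) := (hr.continuousOn x hx).tendsto.comp hlim'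
  have hid : Tendsto (fun d : ℝ => d) U (𝓝 c) := hU
  refine le_of_tendsto_of_tendsto' (tendsto_const_nhds.add (tendsto_const_nhds.mul hid))
    (hr'.add ((tendsto_const_nhds.sub hlim).mul hid)) fun d => ?_
  exact (sStar_isLeast hr d).1.2 t ht

/-- The envelope theorem for the value function at a point with a unique maximizer. -/
theorem IsRegularRevenue.hasDerivAt_value (hr : IsRegularRevenue r) {c : ℝ}
    (hc : (maximizers r c).Subsingleton) : HasDerivAt (value r) (1 - sStar r c) c := by
  rw [hasDerivAt_iff_isLittleO, Asymptotics.isLittleO_iff]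
  intro ε hε
  have h := hr.tendsto_sStar hc
  filter_upwards [Metric.tendsto_nhds.1 h ε hε] with d hd
  have h1 := hr.sub_mul_le_value_sub c d
  have h2 := hr.sub_mul_le_value_sub d c
  rw [Real.dist_eq] at hd
  -- The two subgradient inequalities trap the first-order remainder between 0 and (s*(c) - s*(d))
  -- (d - c).
  have h3 : |(sStar r d - sStar r c) * (d - c)| ≤ ε * |d - c| := by
    rw [abs_mul]
    exact mul_le_mul_of_nonneg_right hd.le (abs_nonneg _)
  have h4 := neg_le_of_abs_le h3
  rw [Real.norm_eq_abs, Real.norm_eq_abs, smul_eq_mul, abs_of_nonneg (by linarith)]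
  linarith

/-- A regular revenue function composed with an a.e. `[0,1]`-valued function is integrable. -/
theorem IsRegularRevenue.integrable_comp (hr : IsRegularRevenue r) {α : Type*}
    [MeasurableSpace α] {μ : Measure α} [IsFiniteMeasure μ] {s : α → ℝ} (hs : Measurable s)
    (hs' : ∀ᵐ x ∂μ, s x ∈ Icc (0 : ℝ) 1) : Integrable (fun x => r (s x)) μ := by
  obtain ⟨M, hM⟩ := hr.bounded
  have hcont : Continuous (IccExtend (zero_le_one' ℝ) ((Icc (0 : ℝ) 1).domRestrict r)) :=
    hr.continuousOn.domRestrict.Icc_extend'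
  have hmeas : AEStronglyMeasurable (fun x => r (s x)) μ := by
    refine ⟨_, (hcont.measurable.comp hs).stronglyMeasurable, ?_⟩
    filter_upwards [hs'] with x hx
    simp [IccExtend_of_mem _ _ hx, domRestrict]
  refine Integrable.of_bound hmeas M ?_
  filter_upwards [hs'] with x hx
  rw [Real.norm_of_nonneg (hr.nonneg _ hx)]
  exact hM _ hx

end Revenue

/-! ### Adjusted qualities, their maximum, and ties. -/

section Adjusted

variable {ι : Type*}

theorem measurable_adj (v : ι → ℝ) (o : Option ι) : Measurable fun q => adj v q o := by
  cases o with
  | none => exact measurable_const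
  | some a => exact (measurable_pi_apply a).sub_const _

variable [Fintype ι]

theorem adj_le_maxAdj (v q : ι → ℝ) (o : Option ι) : adj v q o ≤ maxAdj v q :=
  le_ciSup (finite_range (adj v q)).bddAbove o

theorem exists_adj_eq_maxAdj (v q : ι → ℝ) : ∃ o, adj v q o = maxAdj v q :=
  exists_eq_ciSup_of_finite

theorem maxAdj_eq_of_forall_le {v q : ι → ℝ} {o : Option ι}
    (h : ∀ o', adj v q o' ≤ adj v q o) : maxAdj v q = adj v q o :=
  le_antisymm (ciSup_le h) (adj_le_maxAdj v q o)

theorem maxAdj_nonneg (v q : ι → ℝ) : 0 ≤ maxAdj v q := adj_le_maxAdj v q none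

theorem maxAdj_le_sum (v q : ι → ℝ) : maxAdj v q ≤ ∑ a, |q a - v a| := by
  refine ciSup_le fun o => ?_
  cases o with
  | none => exact Finset.sum_nonneg fun a _ => abs_nonneg _
  | some a =>
    exact (le_abs_self _).trans
      (Finset.single_le_sum (f := fun a => |q a - v a|) (fun _ _ => abs_nonneg _)
        (Finset.mem_univ a))

theorem measurable_maxAdj (v : ι → ℝ) : Measurable (maxAdj v) :=
  Measurable.iSup fun o => measurable_adj v o

theorem abs_maxAdj_sub_le {v w q : ι → ℝ} {K : ℝ} (hK : 0 ≤ K) (h : ∀ a, |v a - w a| ≤ K) :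
    |maxAdj v q - maxAdj w q| ≤ K := by
  have key : ∀ x y : ι → ℝ, (∀ a, |x a - y a| ≤ K) → maxAdj x q ≤ maxAdj y q + K := by
    intro x y hxy
    refine ciSup_le fun o => ?_
    have h1 := adj_le_maxAdj y q o
    cases o with
    | none => exact h1.trans (le_add_of_nonneg_right hK)
    | some a =>
      have h2 := neg_le_of_abs_le (hxy a)
      simp only [adj] at h1 ⊢
      linarith
  have h1 := key v w h
  have h2 := key w v fun a => abs_sub_comm (w a) (v a) ▸ h a
  exact abs_le.2 ⟨by linarith, by linarith⟩

theorem assign_of_forall_lt {v q : ι → ℝ} {a : ι}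
    (h : ∀ o : Option ι, o ≠ some a → adj v q o < adj v q (some a)) : assign v a q = 1 :=
  if_pos h

theorem assign_of_le {v q : ι → ℝ} {a : ι} {o : Option ι} (ho : o ≠ some a)
    (h : adj v q (some a) ≤ adj v q o) : assign v a q = 0 :=
  if_neg fun h' => (h' o ho).not_ge h

theorem assign_nonneg (v q : ι → ℝ) (a : ι) : 0 ≤ assign v a q := by
  unfold assign
  split_ifs <;> norm_num

theorem sub_eq_maxAdj_of_assign_ne_zero {v q : ι → ℝ} {a : ι} (h : assign v a q ≠ 0) :
    q a - v a = maxAdj v q := by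
  have h' : ∀ o : Option ι, o ≠ some a → adj v q o < adj v q (some a) := by
    by_contra hn
    exact h (if_neg hn)
  refine (maxAdj_eq_of_forall_le (o := some a) fun o => ?_).symm
  by_cases ho : o = some a
  · rw [ho]
  · exact (h' o ho).le

theorem measurable_assign (v : ι → ℝ) (a : ι) : Measurable (assign v a) := by
  classical
  refine Measurable.ite ?_ measurable_const measurable_const
  simp only [ofPred_forall]
  exact MeasurableSet.iInter fun o => MeasurableSet.iInter fun _ =>
    measurableSet_lt (measurable_adj v o) (measurable_adj v (some a))

/-- If `o` is a strict maximizer, the assignment is the indicator of `o = some a`. -/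
theorem assign_eq_ite [DecidableEq ι] {v q : ι → ℝ} {o : Option ι}
    (h : ∀ o', o' ≠ o → adj v q o' < adj v q o) (a : ι) :
    assign v a q = if o = some a then 1 else 0 := by
  split_ifs with ho
  · subst ho
    exact assign_of_forall_lt h
  · exact assign_of_le ho (h _ (Ne.symm ho)).le

theorem sum_assign_le_one (v q : ι → ℝ) : ∑ a, assign v a q ≤ 1 := by
  classical
  by_cases h : ∃ a, assign v a q ≠ 0
  · obtain ⟨a, ha⟩ := h
    rw [Finset.sum_eq_single a]
    · unfold assign
      split_ifs <;> norm_num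
    · intro b _ hb
      refine assign_of_le (o := some a) (by simpa using hb.symm) ?_
      exact (adj_le_maxAdj v q _).trans (sub_eq_maxAdj_of_assign_ne_zero ha).ge
    · simp
  · push Not at h
    simp [h]

/-- In the absence of ties, almost surely there is a strict maximizer. -/
theorem ae_exists_strict_max {G : Measure (ι → ℝ)} {v : ι → ℝ}
    (hties : ∀ o o' : Option ι, o ≠ o' → G {q | adj v q o = adj v q o'} = 0) :
    ∀ᵐ q ∂G, ∃ o, adj v q o = maxAdj v q ∧ ∀ o', o' ≠ o → adj v q o' < adj v q o := by
  have h : ∀ᵐ q ∂G, ∀ o o' : Option ι, o ≠ o' → adj v q o ≠ adj v q o' := by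
    rw [ae_all_iff]; intro o
    rw [ae_all_iff]; intro o'
    by_cases ho : o = o'
    · simp [ho]
    · simpa [ae_iff, ho] using hties o o' ho
  filter_upwards [h] with q hq
  obtain ⟨o, ho⟩ := exists_adj_eq_maxAdj v q
  refine ⟨o, ho, fun o' ho' => lt_of_le_of_ne ?_ (hq o' o ho')⟩
  rw [ho]
  exact adj_le_maxAdj v q o'

/-- The envelope theorem for the integrand of the dual, in the direction of one coordinate. -/
theorem hasDerivAt_value_maxAdj_update [DecidableEq ι] {r : ℝ → ℝ} (hr : IsRegularRevenue r)
    {v q : ι → ℝ} {o : Option ι} (ho : adj v q o = maxAdj v q)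
    (hmax : ∀ o', o' ≠ o → adj v q o' < adj v q o)
    (huniq : 0 < maxAdj v q → (maximizers r (maxAdj v q)).Subsingleton) (a : ι) :
    HasDerivAt (fun x => value r (maxAdj (Function.update v a x) q))
      (-((1 - sStar r (maxAdj v q)) * assign v a q)) (v a) := by
  have hcont : ∀ o', Continuous fun x => adj (Function.update v a x) q o' := by
    intro o'
    cases o' with
    | none => exact continuous_const
    | some b =>
      simp only [adj]
      fun_prop
  -- Strict maximality survives small price changes, there being finitely many options.
  have hev : ∀ᶠ x in 𝓝 (v a), ∀ o', o' ≠ o →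
      adj (Function.update v a x) q o' < adj (Function.update v a x) q o := by
    rw [eventually_all]
    intro o'
    by_cases h : o' = o
    · simp [h]
    · have := (hcont o').continuousAt.eventually_lt (hcont o).continuousAt
        (x₀ := v a) (by simpa using hmax o' h)
      filter_upwards [this] with x hx _ using hx
  have heq : (fun x => value r (maxAdj (Function.update v a x) q)) =ᶠ[𝓝 (v a)]
      fun x => value r (adj (Function.update v a x) q o) := by
    filter_upwards [hev] with x hx
    rw [maxAdj_eq_of_forall_le (o := o) fun o' => ?_]
    by_cases h : o' = o
    · rw [h]
    · exact (hx o' h).le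
  refine HasDerivAt.congr_of_eventuallyEq ?_ heq
  rw [assign_eq_ite hmax]
  split_ifs with h
  · subst h
    -- The winner a strictly beats the outside option, whose value is 0, so uniqueness of the
    -- maximizer is available.
    have hpos : 0 < maxAdj v q := by
      rw [← ho]
      exact hmax none (by simp)
    have hd := hr.hasDerivAt_value (huniq hpos)
    have hlin : HasDerivAt (fun x : ℝ => q a - x) (-1) (v a) := by
      simpa using (hasDerivAt_id (v a)).const_sub (q a)
    have hval : q a - v a = maxAdj v q := ho
    rw [← hval] at hd ⊢
    simpa [adj, Function.comp_def] using HasDerivAt.comp (v a) hd hlin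
  -- When a is not the winner the integrand is locally constant in its price; R need not be
  -- differentiable at λ, which covers λ = 0.
  · have : (fun x => value r (adj (Function.update v a x) q o)) = fun _ => value r (adj v q o) := by
      funext x
      cases o with
      | none => rfl
      | some b =>
        have hb : b ≠ a := fun hb => h (by rw [hb])
        simp [adj, hb]
    rw [this]
    simpa using hasDerivAt_const (v a) (value r (adj v q o))

end Adjusted

/-! ### First-order condition, weak duality, and attainment. -/

section Duality

variable {ι : Type*} [Fintype ι] {G : Measure (ι → ℝ)} [IsProbabilityMeasure G]

theorem integrable_maxAdj (hG : ∀ a, Integrable (fun q : ι → ℝ => q a) G) (v : ι → ℝ) :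
    Integrable (maxAdj v) G := by
  refine Integrable.mono' (g := fun q => ∑ a, |q a - v a|) ?_
    (measurable_maxAdj v).aestronglyMeasurable (Eventually.of_forall fun q => ?_)
  · exact integrable_finsetSum _ fun a _ => ((hG a).sub (integrable_const (v a))).abs
  · rw [Real.norm_of_nonneg (maxAdj_nonneg v q)]
    exact maxAdj_le_sum v q

theorem integrable_value_maxAdj {r : ℝ → ℝ} (hr : IsRegularRevenue r)
    (hG : ∀ a, Integrable (fun q : ι → ℝ => q a) G) (v : ι → ℝ) :
    Integrable (fun q => value r (maxAdj v q)) G := by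
  refine Integrable.mono' (g := fun q => |value r 0| + maxAdj v q)
    ((integrable_const _).add (integrable_maxAdj hG v))
    (hr.continuous_value.measurable.comp (measurable_maxAdj v)).aestronglyMeasurable
    (Eventually.of_forall fun q => ?_)
  have h1 := hr.abs_value_sub_le (maxAdj v q) 0
  rw [sub_zero, abs_of_nonneg (maxAdj_nonneg v q)] at h1
  have h2 := abs_sub_abs_le_abs_sub (value r (maxAdj v q)) (value r 0)
  rw [Real.norm_eq_abs]
  linarith

/-- The first-order condition satisfied by optimal dual variables. -/
theorem integral_assign_eq {r : ℝ → ℝ} (hr : IsRegularRevenue r)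
    (hG : ∀ a, Integrable (fun q : ι → ℝ => q a) G) {ρ v : ι → ℝ} (hv : IsDualOptimal G r ρ v)
    (hties : ∀ o o' : Option ι, o ≠ o' → G {q | adj v q o = adj v q o'} = 0)
    (huniq : ∀ᵐ q ∂G, 0 < maxAdj v q → (maximizers r (maxAdj v q)).Subsingleton) (a : ι) :
    ∫ q, (1 - sStar r (maxAdj v q)) * assign v a q ∂G = ρ a := by
  classical
  have hder := (hasDerivAt_integral_of_dominated_loc_of_lip (μ := G) (x₀ := v a)
    (F := fun x q => value r (maxAdj (Function.update v a x) q))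
    (F' := fun q => -((1 - sStar r (maxAdj v q)) * assign v a q))
    -- R and the maximum are both 1-Lipschitz, so the constant 1 dominates globally.
    (s := univ) (bound := fun _ => 1) univ_mem
    (Eventually.of_forall fun x => (integrable_value_maxAdj hr hG _).aestronglyMeasurable)
    (integrable_value_maxAdj hr hG _)
    (((measurable_const.sub (hr.antitone_sStar.measurable.comp (measurable_maxAdj v))).mul
      (measurable_assign v a)).neg.aestronglyMeasurable)
    (Eventually.of_forall fun q => LipschitzOnWith.of_dist_le_mul fun x _ y _ => by
      rw [Real.dist_eq, Real.dist_eq]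
      refine (hr.abs_value_sub_le _ _).trans ?_
      simp only [map_one, NNReal.coe_one, one_mul]
      refine abs_maxAdj_sub_le (abs_nonneg _) fun b => ?_
      by_cases hb : b = a
      · subst hb
        simp
      · simp [hb])
    (integrable_const 1)
    (by
      filter_upwards [ae_exists_strict_max hties, huniq] with q ⟨o, ho, hmax⟩ hq
      exact hasDerivAt_value_maxAdj_update hr ho hmax hq a)).2
  have hlin : HasDerivAt (fun x => ∑ b, Function.update v a x b * ρ b) (ρ a) (v a) := by
    have h : (fun x => ∑ b, Function.update v a x b * ρ b) =
        fun x => x * ρ a + ∑ b ∈ Finset.univ.erase a, v b * ρ b := by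
      funext x
      rw [← Finset.add_sum_erase _ _ (Finset.mem_univ a)]
      congr 1
      · simp
      · refine Finset.sum_congr rfl fun b hb => ?_
        rw [Function.update_of_ne (Finset.ne_of_mem_erase hb)]
    rw [h]
    simpa using ((hasDerivAt_id (v a)).mul_const (ρ a)).add_const
      (∑ b ∈ Finset.univ.erase a, v b * ρ b)
  have hmin : IsLocalMin (fun x => dual G r ρ (Function.update v a x)) (v a) := by
    refine Eventually.of_forall fun x => ?_
    simpa using hv (Function.update v a x)
  have h0 := hmin.hasDerivAt_eq_zero (hder.add hlin)
  rw [integral_neg] at h0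
  linarith

/-- A control takes values in `[0,1]`. -/
theorem IsControl.mem_Icc {Ω : Set (ι → ℝ)} {s : (ι → ℝ) → ℝ} {i : ι → (ι → ℝ) → ℝ}
    (h : IsControl Ω s i) {q : ι → ℝ} (hq : q ∈ Ω) :
    s q ∈ Icc (0 : ℝ) 1 ∧ ∀ a, i a q ∈ Icc (0 : ℝ) 1 := by
  have h0 := h.nonneg_s q hq
  have h1 := h.nonneg_i q hq
  have h2 := h.sum_le_one q hq
  have h3 := Finset.sum_nonneg fun a (_ : a ∈ Finset.univ) => h1 a
  refine ⟨⟨h0, by linarith⟩, fun a => ⟨h1 a, ?_⟩⟩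
  have := Finset.single_le_sum (f := fun a => i a q) (fun a _ => h1 a) (Finset.mem_univ a)
  linarith

theorem IsControl.integrable_i {Ω : Set (ι → ℝ)} (hGΩ : ∀ᵐ q ∂G, q ∈ Ω)
    {s : (ι → ℝ) → ℝ} {i : ι → (ι → ℝ) → ℝ} (h : IsControl Ω s i) (a : ι) :
    Integrable (i a) G := by
  refine Integrable.of_bound (h.measurable_i a).aestronglyMeasurable 1 ?_
  filter_upwards [hGΩ] with q hq
  obtain ⟨h0, h1⟩ := (h.mem_Icc hq).2 a
  rwa [Real.norm_of_nonneg h0]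

theorem IsControl.integrable_yield {r : ℝ → ℝ} (hr : IsRegularRevenue r) {Ω : Set (ι → ℝ)}
    (hGΩ : ∀ᵐ q ∂G, q ∈ Ω) (hG : ∀ a, Integrable (fun q : ι → ℝ => q a) G)
    {s : (ι → ℝ) → ℝ} {i : ι → (ι → ℝ) → ℝ} (h : IsControl Ω s i) :
    Integrable (fun q => r (s q) + ∑ a, i a q * q a) G := by
  refine (hr.integrable_comp h.measurable_s ?_).add (integrable_finsetSum _ fun a _ => ?_)
  · filter_upwards [hGΩ] with q hq using (h.mem_Icc hq).1
  · refine (hG a).bdd_mul (c := 1) (h.measurable_i a).aestronglyMeasurable ?_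
    filter_upwards [hGΩ] with q hq
    obtain ⟨h0, h1⟩ := (h.mem_Icc hq).2 a
    rwa [Real.norm_of_nonneg h0]

/-- Write Q_a = (Q_a - v_a) + v_a and bound the bracket by λ. Since λ ≥ 0 thanks to the outside
option, ∑ i_a may then be raised to 1 - s. -/
theorem IsControl.yield_le_value {r : ℝ → ℝ} (hr : IsRegularRevenue r) {Ω : Set (ι → ℝ)}
    {s : (ι → ℝ) → ℝ} {i : ι → (ι → ℝ) → ℝ} (h : IsControl Ω s i) (v : ι → ℝ)
    {q : ι → ℝ} (hq : q ∈ Ω) :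
    r (s q) + ∑ a, i a q * q a ≤ value r (maxAdj v q) + ∑ a, v a * i a q := by
  have h1 : ∑ a, i a q * q a ≤ ∑ a, (i a q * maxAdj v q + v a * i a q) := by
    refine Finset.sum_le_sum fun a _ => ?_
    have h2 : q a - v a ≤ maxAdj v q := adj_le_maxAdj v q (some a)
    have h3 := mul_le_mul_of_nonneg_left h2 (h.nonneg_i q hq a)
    linarith
  rw [Finset.sum_add_distrib, ← Finset.sum_mul] at h1
  have h4 : ∑ a, i a q ≤ 1 - s q := by linarith [h.sum_le_one q hq]
  have h5 := mul_le_mul_of_nonneg_right h4 (maxAdj_nonneg v q)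
  have h6 := hr.le_value (maxAdj v q) (h.mem_Icc hq).1
  linarith

/-- The capacity constraint makes the priced bound independent of the control. -/
theorem sum_integral_value_add {N : ℕ} {r : ℝ → ℝ} (hr : IsRegularRevenue r) {Ω : Set (ι → ℝ)}
    (hGΩ : ∀ᵐ q ∂G, q ∈ Ω) (hG : ∀ a, Integrable (fun q : ι → ℝ => q a) G) {ρ : ι → ℝ}
    {s : Fin N → (ι → ℝ) → ℝ} {i : Fin N → ι → (ι → ℝ) → ℝ} (h : IsFeasible Ω G ρ s i)
    (v : ι → ℝ) :
    ∑ n, ∫ q, (value r (maxAdj v q) + ∑ a, v a * i n a q) ∂G = N * dual G r ρ v := by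
  have h1 : ∀ n, ∫ q, (value r (maxAdj v q) + ∑ a, v a * i n a q) ∂G =
      ∫ q, value r (maxAdj v q) ∂G + ∑ a, v a * ∫ q, i n a q ∂G := by
    intro n
    have hi : ∀ a ∈ Finset.univ, Integrable (fun q => v a * i n a q) G := fun a _ =>
      ((h.control n).integrable_i hGΩ a).const_mul (v a)
    rw [integral_add (integrable_value_maxAdj hr hG v) (integrable_finsetSum _ hi),
      integral_finsetSum _ hi]
    simp only [integral_const_mul]
  simp only [h1, Finset.sum_add_distrib, Finset.sum_const, Finset.card_univ, Fintype.card_fin,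
    nsmul_eq_mul]
  rw [Finset.sum_comm, dual, mul_add, Finset.mul_sum]
  congr 1
  refine Finset.sum_congr rfl fun a _ => ?_
  rw [← Finset.mul_sum, h.capacity a]
  ring

/-- Weak duality for the deterministic approximation problem. -/
theorem IsFeasible.yield_le_dual {N : ℕ} {r : ℝ → ℝ} (hr : IsRegularRevenue r)
    {Ω : Set (ι → ℝ)} (hGΩ : ∀ᵐ q ∂G, q ∈ Ω) (hG : ∀ a, Integrable (fun q : ι → ℝ => q a) G)
    {ρ : ι → ℝ} {s : Fin N → (ι → ℝ) → ℝ} {i : Fin N → ι → (ι → ℝ) → ℝ}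
    (h : IsFeasible Ω G ρ s i) (v : ι → ℝ) : yield G r s i ≤ N * dual G r ρ v := by
  rw [← sum_integral_value_add hr hGΩ hG h v]
  refine Finset.sum_le_sum fun n _ => integral_mono_ae
    ((h.control n).integrable_yield hr hGΩ hG)
    ((integrable_value_maxAdj hr hG v).add (integrable_finsetSum _ fun a _ =>
      ((h.control n).integrable_i hGΩ a).const_mul (v a))) ?_
  filter_upwards [hGΩ] with q hq using (h.control n).yield_le_value hr v hq

theorem isControl_sStar_assign {r : ℝ → ℝ} (hr : IsRegularRevenue r) (Ω : Set (ι → ℝ))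
    (v : ι → ℝ) :
    IsControl Ω (fun q => sStar r (maxAdj v q))
      (fun a q => (1 - sStar r (maxAdj v q)) * assign v a q) where
  measurable_s := hr.antitone_sStar.measurable.comp (measurable_maxAdj v)
  measurable_i a := (measurable_const.sub
    (hr.antitone_sStar.measurable.comp (measurable_maxAdj v))).mul (measurable_assign v a)
  nonneg_s q _ := (hr.sStar_mem_Icc _).1
  nonneg_i q _ a := mul_nonneg (sub_nonneg.2 (hr.sStar_mem_Icc _).2) (assign_nonneg v q a)
  sum_le_one q _ := by
    rw [← Finset.mul_sum]
    have := mul_le_of_le_one_right (sub_nonneg.2 (hr.sStar_mem_Icc (maxAdj v q)).2)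
      (sum_assign_le_one v q)
    linarith

/-- Complementary slackness: the rejected mass goes entirely to the strict winner, or is left
unassigned when λ = 0. -/
theorem yield_sStar_assign_eq {r : ℝ → ℝ} (hr : IsRegularRevenue r) {v q : ι → ℝ}
    {o : Option ι} (ho : adj v q o = maxAdj v q)
    (hmax : ∀ o', o' ≠ o → adj v q o' < adj v q o) :
    r (sStar r (maxAdj v q)) + ∑ a, (1 - sStar r (maxAdj v q)) * assign v a q * q a =
      value r (maxAdj v q) + ∑ a, v a * ((1 - sStar r (maxAdj v q)) * assign v a q) := by
  classical
  rw [hr.value_eq]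
  simp only [assign_eq_ite hmax]
  cases o with
  | none =>
    rw [← ho]
    simp [adj]
  | some b =>
    have hb : q b - v b = maxAdj v q := ho
    simp only [Option.some.injEq, mul_ite, ite_mul, mul_one, mul_zero, zero_mul,
      Finset.sum_ite_eq, Finset.mem_univ, if_true]
    linear_combination (1 - sStar r (maxAdj v q)) * hb

end Duality

end AdX

theorem mainTheorem3 {ι : Type*} [Fintype ι] (N : ℕ)
    (Ω : Set (ι → ℝ)) (hΩ : MeasurableSet Ω)
    (G : Measure (ι → ℝ)) [IsProbabilityMeasure G] (hGΩ : ∀ᵐ q ∂G, q ∈ Ω)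
    (hG2 : ∀ a, MemLp (fun q : ι → ℝ => q a) 2 G)
    (r : ℝ → ℝ) (hr : AdX.IsRegularRevenue r)
    (ρ v : ι → ℝ) (hv : AdX.IsDualOptimal G r ρ v)
    (hties : ∀ o o' : Option ι, o ≠ o' → G {q | AdX.adj v q o = AdX.adj v q o'} = 0)
    (huniq : ∀ᵐ q ∂G, 0 < AdX.maxAdj v q → (AdX.maximizers r (AdX.maxAdj v q)).Subsingleton) :
    (∀ᵐ q ∂G, ∃! o : Option ι, AdX.adj v q o = AdX.maxAdj v q) ∧
    AdX.IsOptimal (N := N) Ω G r ρ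
      (fun _ q => AdX.sStar r (AdX.maxAdj v q))
      (fun _ a q => (1 - AdX.sStar r (AdX.maxAdj v q)) * AdX.assign v a q) ∧
    ∀ a : ι, ∫ q, (1 - AdX.sStar r (q a - v a)) * AdX.assign v a q ∂G = ρ a := by

  have hG : ∀ a, Integrable (fun q : ι → ℝ => q a) G := fun a =>
    (hG2 a).integrable one_le_two
  have hstrict := AdX.ae_exists_strict_max hties
  have hfoc := AdX.integral_assign_eq hr hG hv hties huniq
  have hfeas : AdX.IsFeasible (N := N) Ω G ρ (fun _ q => AdX.sStar r (AdX.maxAdj v q))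
      (fun _ a q => (1 - AdX.sStar r (AdX.maxAdj v q)) * AdX.assign v a q) :=
    ⟨fun _ => AdX.isControl_sStar_assign hr Ω v, fun a => by simp [hfoc a]⟩
  refine ⟨?_, ⟨hfeas, fun s' i' h' => ?_⟩, fun a => ?_⟩
  · filter_upwards [hstrict] with q ⟨o, ho, hmax⟩
    refine ⟨o, ho, fun o' ho' => ?_⟩
    by_contra hne
    exact (hmax o' hne).ne (ho'.trans ho.symm)
  · refine (h'.yield_le_dual hr hGΩ hG v).trans_eq ?_
    -- Rewriting N ψ(v) through the policy's own capacity identity reduces attainment to a pointwise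
    -- equality.
    rw [← AdX.sum_integral_value_add hr hGΩ hG hfeas v]
    refine Finset.sum_congr rfl fun n _ => integral_congr_ae ?_
    filter_upwards [hstrict] with q ⟨o, ho, hmax⟩
    exact (AdX.yield_sStar_assign_eq hr ho hmax).symm
  · rw [← hfoc a]
    congr 1
    funext q
    by_cases h : AdX.assign v a q = 0
    · simp [h]
    · rw [AdX.sub_eq_maxAdj_of_assign_ne_zero h]
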